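/- Let $k$ be a perfect field of characteristic $p>0$, let $n\ge 0$, and let $R=k[x_1,\dots,x_n]$ or $R=k[[x_1,\dots,x_n]]$. For $e\ge 1$ and an ideal $J\subseteq R$ let $I_e(J)$ be the smallest ideal $I$ of $R$ with $J\subseteq I^{[p^e]}$, where $I^{[p^e]}$ is the ideal generated by the elements $x^{p^e}$, $x\in I$. For a real number $t\ge 0$ let $\tau(J^t)=\bigcup_{e\ge 1} I_e\big(J^{\lceil tp^e\rceil}\big)$. A real number $c>0$ is an $F$-jumping coefficient of $f\in R$ if $\tau((f)^c)\subsetneq\tau((f)^{c'})$ for all $0\le c'<c$. Let $f\in R$ be nonzero with at most isolated singularities, that is, every prime ideal of $R/(f)$ at which the local ring is not regular is a maximal ideal, and let $\mathrm{Jac}(f)=\left(f,\frac{\partial f}{\partial x_1},\dots,\frac{\partial f}{\partial x_n}\right)$. Then $\dim_k(R/\mathrm{Jac}(f))$ is finite, and $f$ has at most $\dim_k(R/\mathrm{Jac}(f))+1$ $F$-jumping coefficients in $[0,1]$. -/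

import Mathlib

namespace FJump

/-- The Frobenius power `I^[p^e]`: the ideal generated by all `x ^ (p ^ e)` with `x` in `I`. -/
def frobeniusPower {R : Type*} [CommRing R] (p : ℕ) (I : Ideal R) (e : ℕ) : Ideal R :=
  Ideal.span ((fun x : R => x ^ (p ^ e)) '' (I : Set R))

/-- `I_e(J)`: the smallest ideal `I` with `J ⊆ I^[p^e]`, taken as the intersection of all such
ideals; in an `F`-finite regular ring this intersection is itself such an ideal. -/
def frobeniusRoot {R : Type*} [CommRing R] (p : ℕ) (e : ℕ) (J : Ideal R) : Ideal R :=
  sInf {I : Ideal R | J ≤ frobeniusPower p I e}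

/-- The generalized test ideal `τ(J^t)`, for `t ≥ 0`: the union over all positive integers `e` of
the ideals `I_e(J ^ ⌈t * p ^ e⌉)`. The union is taken as a supremum of ideals; for principal `J`
in an `F`-finite regular ring the family is an ascending chain, so the two coincide. -/
noncomputable def testIdeal {R : Type*} [CommRing R] (p : ℕ) (J : Ideal R) (t : ℝ) : Ideal R :=
  ⨆ (e : ℕ) (_ : 1 ≤ e), frobeniusRoot p e (J ^ ⌈t * (p : ℝ) ^ e⌉₊)

/-- `c` is an `F`-jumping coefficient of `J`: a positive real number with
`τ(J^c) ⊊ τ(J^c')` for every `0 ≤ c' < c`. -/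
def IsFJumpingCoefficient {R : Type*} [CommRing R] (p : ℕ) (J : Ideal R) (c : ℝ) : Prop :=
  0 < c ∧ ∀ c' : ℝ, 0 ≤ c' → c' < c → testIdeal p J c < testIdeal p J c'

/-- The hypersurface ring `R/(f)` has (at most) isolated singularities: every prime at which the
local ring of `R/(f)` is not regular is a maximal ideal. -/
def HasIsolatedSingularity {R : Type*} [CommRing R] (f : R) : Prop :=
  ∀ (P : Ideal (R ⧸ Ideal.span {f})) [P.IsPrime],
    ¬ IsRegularLocalRing (Localization.AtPrime P) → P.IsMaximal

/-- `Jac(f) = (f, ∂f/∂x_1, …, ∂f/∂x_n)` in `k[x_1,…,x_n]`. -/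
noncomputable def polyJac {k : Type*} [Field k] {n : ℕ} (f : MvPolynomial (Fin n) k) :
    Ideal (MvPolynomial (Fin n) k) :=
  Ideal.span (insert f (Set.range fun i : Fin n => MvPolynomial.pderiv i f))

/-- `Jac(f) = (f, ∂f/∂x_1, …, ∂f/∂x_n)` in `k[[x_1,…,x_n]]`. -/
noncomputable def seriesJac {k : Type*} [Field k] {n : ℕ} (f : MvPowerSeries (Fin n) k) :
    Ideal (MvPowerSeries (Fin n) k) :=
  Ideal.span (insert f (Set.range fun i : Fin n => MvPowerSeries.pderiv k i f))

end FJump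

/-! A `p⁻¹`-linear map `φ : R → R` satisfies `φ^[e] (I^[p^e]) ⊆ I`. Hence if
`φ (f ^ (p - 1) * g) = g`, then `φ^[e] (f ^ (p ^ e - 1) * g) = g` for all `e`, so that `g ∈ τ(f^c)`
for every `c < 1`. Now the Cartier operator `C` fixes logarithmic differentials, that is
`C (f ^ (p - 1) * df) = df`, and its coordinates with respect to a `p`-basis are `p⁻¹`-linear maps;
this yields `Jac(f) ⊆ τ(f^c)` for `c < 1`.

By the Jacobian criterion a prime containing `Jac(f)` is a non-regular point of `R / (f)`, hence
maximal, so `R / Jac(f)` has finite length. The numbers `dim_k R / τ(f^c)` with `c < 1` are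
therefore bounded by `dim_k R / Jac(f)`, and they increase strictly at each jump.
-/

namespace FJump

open IsLocalRing

section CartierLinear

variable {R : Type*} [CommRing R] {p : ℕ} {φ : R →+ R}

/-- `φ` is `p⁻¹`-linear: in characteristic `p` these are the `R`-linear maps `F_* R → R`, where `F`
is the Frobenius endomorphism. -/
def IsCartierLinear (p : ℕ) (φ : R →+ R) : Prop :=
  ∀ r s : R, φ (r * s ^ p) = s * φ r

namespace IsCartierLinear

theorem iterate_mul_pow (hφ : IsCartierLinear p φ) (e : ℕ) (r s : R) :
  φ^[e] (r * s ^ p ^ e) = s * φ^[e] r := by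
  induction e generalizing r with
  | zero => simp [mul_comm]
  | succ e ih =>
    rw [Function.iterate_succ_apply, pow_succ, pow_mul, hφ, mul_comm, ih,
      Function.iterate_succ_apply]

theorem iterate_mem_of_mem_frobeniusPower (hφ : IsCartierLinear p φ) {I : Ideal R} {e : ℕ} {r : R}
    (hr : r ∈ frobeniusPower p I e) : φ^[e] r ∈ I := by
  rw [frobeniusPower, Ideal.span, ← Submodule.mem_toAddSubmonoid] at hr
  refine Submodule.closure_induction (p := fun y _ => φ^[e] y ∈ I) ?_ ?_ ?_ hr
  · simp
  · intro x y _ _ hx hy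
    rw [iterate_map_add]
    exact add_mem hx hy
  · rintro a _ ⟨s, hs, rfl⟩
    rw [smul_eq_mul, hφ.iterate_mul_pow]
    exact I.mul_mem_right _ hs

theorem iterate_pow_mul_eq_self (hφ : IsCartierLinear p φ) (hp : 0 < p) {f g : R}
    (hg : φ (f ^ (p - 1) * g) = g) (e : ℕ) : φ^[e] (f ^ (p ^ e - 1) * g) = g := by
  induction e with
  | zero => simp
  | succ e ih =>
    have hexp : p ^ (e + 1) - 1 = (p - 1) + (p ^ e - 1) * p := by
      zify [Nat.one_le_pow (e + 1) p hp, Nat.one_le_pow e p hp, Nat.one_le_of_lt hp]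
      ring
    rw [Function.iterate_succ_apply, hexp, pow_add, pow_mul, mul_right_comm, hφ, hg, ih]

theorem mem_frobeniusRoot (hφ : IsCartierLinear p φ) (hp : 0 < p) {f g : R}
    (hg : φ (f ^ (p - 1) * g) = g) {e m : ℕ} (hm : m ≤ p ^ e - 1) :
    g ∈ frobeniusRoot p e (Ideal.span {f} ^ m) := by
  refine Submodule.mem_sInf.mpr fun I hI => ?_
  have hf : f ^ (p ^ e - 1) ∈ frobeniusPower p I e :=
    hI (Ideal.pow_le_pow_right hm (Ideal.pow_mem_pow (Ideal.mem_span_singleton_self f) _))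
  rw [← hφ.iterate_pow_mul_eq_self hp hg e]
  exact hφ.iterate_mem_of_mem_frobeniusPower (Ideal.mul_mem_right _ _ hf)

end IsCartierLinear

theorem exists_ceil_mul_pow_le_pow_sub_one (hp : 1 < p) {c : ℝ} (hc : c < 1) :
    ∃ e : ℕ, 1 ≤ e ∧ ⌈c * (p : ℝ) ^ e⌉₊ ≤ p ^ e - 1 := by
  have hp' : 1 < (p : ℝ) := by exact_mod_cast hp
  obtain ⟨e, he⟩ := pow_unbounded_of_one_lt (1 / (1 - c)) hp'
  refine ⟨e + 1, by omega, ?_⟩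
  have he' : 1 / (1 - c) < (p : ℝ) ^ (e + 1) := he.trans (pow_lt_pow_right₀ hp' e.lt_succ_self)
  rw [div_lt_iff₀ (by linarith)] at he'
  rw [Nat.ceil_le]
  push_cast [Nat.one_le_pow (e + 1) p (by omega)]
  linarith

theorem IsCartierLinear.mem_testIdeal (hφ : IsCartierLinear p φ) (hp : 1 < p) {f g : R}
    (hg : φ (f ^ (p - 1) * g) = g) {c : ℝ} (hc : c < 1) :
    g ∈ testIdeal p (Ideal.span {f}) c := by
  obtain ⟨e, he, hceil⟩ := exists_ceil_mul_pow_le_pow_sub_one hp hc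
  exact Submodule.mem_iSup_of_mem e
    (Submodule.mem_iSup_of_mem he (hφ.mem_frobeniusRoot (by omega) hg hceil))

end CartierLinear

section CartierOperator

open Finset

theorem mul_choose_div_prime {p : ℕ} (hp : p.Prime) {k : ℕ} (hk : k + 1 < p) :
    (k + 1) * (p.choose (k + 1) / p) = (p - 1).choose k ∧
      (p - 1 - k) * (p.choose (k + 1) / p) = (p - 1).choose (k + 1) := by
  obtain ⟨n, rfl⟩ : ∃ n, p = n + 1 := ⟨p - 1, by omega⟩
  obtain ⟨c, hc⟩ := hp.dvd_choose_self k.succ_ne_zero hk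
  have hleft : (k + 1) * c = n.choose k := by
    have := Nat.add_one_mul_choose_eq n k
    rw [hc, mul_assoc, mul_comm c] at this
    exact (Nat.eq_of_mul_eq_mul_left n.succ_pos this).symm
  rw [hc, Nat.mul_div_cancel_left _ n.succ_pos, Nat.add_sub_cancel]
  refine ⟨hleft, Nat.eq_of_mul_eq_mul_right k.succ_pos ?_⟩
  rw [Nat.choose_succ_right_eq, ← hleft, Nat.succ_eq_add_one]
  ring

/-- This is additivity of the inverse Cartier operator `D x ↦ x ^ (p - 1) • D x` modulo exact
differentials; formally `h` is `((x + y) ^ p - x ^ p - y ^ p) / p`. -/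
theorem exists_derivation_eq_pow_smul_sub {A R M : Type*} [CommRing A] [CommRing R] [Algebra A R]
    [AddCommGroup M] [Module A M] [Module R M] (D : Derivation A R M) {p : ℕ} (hp : p.Prime)
    (x y : R) :
    ∃ h : R, D h = (x + y) ^ (p - 1) • D (x + y) - x ^ (p - 1) • D x - y ^ (p - 1) • D y := by
  obtain ⟨n, rfl⟩ : ∃ n, p = n + 1 := ⟨p - 1, (Nat.sub_add_cancel hp.one_le).symm⟩
  have hchoose {k : ℕ} (hk : k ∈ range n) := mul_choose_div_prime hp (k := k)
    (by simpa using mem_range.mp hk)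
  simp only [Nat.add_sub_cancel] at hchoose ⊢
  have hx : ∑ k ∈ range n, x ^ k * y ^ (n - k) * (n.choose k : R) = (x + y) ^ n - x ^ n := by
    simp [add_pow, sum_range_succ]
  have hy : ∑ k ∈ range n, x ^ (k + 1) * y ^ (n - (k + 1)) * (n.choose (k + 1) : R) =
      (x + y) ^ n - y ^ n := by
    simp [add_pow, sum_range_succ']
  refine ⟨∑ k ∈ range n, (((n + 1).choose (k + 1) / (n + 1) : ℕ) : R) * (x ^ (k + 1) * y ^ (n - k)),
    ?_⟩
  calc _ = ∑ k ∈ range n, ((x ^ k * y ^ (n - k) * (n.choose k : R)) • D x +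
        (x ^ (k + 1) * y ^ (n - (k + 1)) * (n.choose (k + 1) : R)) • D y) := by
        rw [map_sum]
        refine sum_congr rfl fun k hk => ?_
        rw [← (hchoose hk).1, ← (hchoose hk).2]
        simp only [Derivation.leibniz, Derivation.leibniz_pow, Derivation.map_natCast]
        push_cast [Nat.sub_sub]
        module
    _ = ((x + y) ^ n - x ^ n) • D x + ((x + y) ^ n - y ^ n) • D y := by
        rw [sum_add_distrib, ← sum_smul, ← sum_smul, hx, hy]
    _ = _ := by
        rw [map_add]
        module

variable {A R : Type*} [CommRing A] [CommRing R] [Algebra A R] {p : ℕ} {φ : R →+ R}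

/-- The map `r ↦ φ (r ^ (p - 1) * D r)` attached to a `p⁻¹`-linear `φ` killing the image of `D`: the
inverse Cartier operator followed by a coordinate of the Cartier operator. -/
def cartierDerivation (hp : p.Prime) (hφ : IsCartierLinear p φ) (D : Derivation A R R)
    (hD : ∀ r, φ (D r) = 0) : Derivation ℤ R R :=
  Derivation.mk' (AddMonoidHom.mk' (fun r => φ (r ^ (p - 1) * D r)) fun x y => by
    obtain ⟨h, hh⟩ := exists_derivation_eq_pow_smul_sub D hp x y
    have := hD h
    simp only [hh, smul_eq_mul, map_sub] at this
    linear_combination this).toIntLinearMap fun x y => by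
    have hpow (r : R) : r ^ p = r ^ (p - 1) * r := (pow_sub_one_mul hp.ne_zero r).symm
    change φ ((x * y) ^ (p - 1) * D (x * y)) =
      x • φ (y ^ (p - 1) * D y) + y • φ (x ^ (p - 1) * D x)
    rw [smul_eq_mul, smul_eq_mul, ← hφ, ← hφ, ← map_add, hpow, hpow, D.leibniz, smul_eq_mul,
      smul_eq_mul]
    congr 1
    ring

theorem cartierDerivation_apply (hp : p.Prime) (hφ : IsCartierLinear p φ) (D : Derivation A R R)
    (hD : ∀ r, φ (D r) = 0) (r : R) :
    cartierDerivation hp hφ D hD r = φ (r ^ (p - 1) * D r) :=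
  rfl

end CartierOperator

section PBasis

open Finset

theorem derivation_pow_char {A R M : Type*} [CommRing A] [CommRing R] [Algebra A R]
    [AddCommGroup M] [Module A M] [Module R M] (D : Derivation A R M) (p : ℕ) [CharP R p]
    (r : R) : D (r ^ p) = 0 := by
  rw [D.leibniz_pow, ← Nat.cast_smul_eq_nsmul R, CharP.cast_eq_zero, zero_smul]

variable {R : Type*} [CommRing R] {p : ℕ} {ι : Type*} [Fintype ι] [DecidableEq ι]
  {x : ι → R}

/-- `x` is a `p`-basis: every element of `R` is uniquely a sum of `p`-th powers times monomials in
`x` with exponents less than `p`. Uniqueness of the coefficients, rather than of their `p`-th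
powers, makes the Frobenius endomorphism injective. -/
def IsPBasis (p : ℕ) (x : ι → R) : Prop :=
  Function.Bijective fun g : (ι → Fin p) → R => ∑ a, (∏ i, x i ^ (a i : ℕ)) * g a ^ p

namespace IsPBasis

section Coord

variable [Fact p.Prime] [CharP R p]

/-- The coordinates of an element with respect to a `p`-basis. -/
noncomputable def coord (hx : IsPBasis p x) (a : ι → Fin p) : R →+ R :=
  (Pi.evalAddMonoidHom (fun _ => R) a).comp
    (AddEquiv.ofBijective (AddMonoidHom.mk' (fun g : (ι → Fin p) → R =>
      ∑ a, (∏ i, x i ^ (a i : ℕ)) * g a ^ p) fun g h => by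
        simp only [Pi.add_apply, add_pow_char, mul_add, sum_add_distrib]) hx).symm.toAddMonoidHom

theorem sum_coord (hx : IsPBasis p x) (r : R) :
    ∑ a, (∏ i, x i ^ (a i : ℕ)) * hx.coord a r ^ p = r :=
  (AddEquiv.ofBijective (AddMonoidHom.mk' _ _) hx).apply_symm_apply r

theorem coord_sum (hx : IsPBasis p x) (g : (ι → Fin p) → R) (a : ι → Fin p) :
    hx.coord a (∑ a, (∏ i, x i ^ (a i : ℕ)) * g a ^ p) = g a :=
  congrFun ((AddEquiv.ofBijective (AddMonoidHom.mk' _ _) hx).symm_apply_apply g) a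

theorem isCartierLinear_coord (hx : IsPBasis p x) (a : ι → Fin p) :
    IsCartierLinear p (hx.coord a) := fun r s => by
  conv_lhs => rw [← hx.sum_coord r, sum_mul]
  rw [← hx.coord_sum (fun b => s * hx.coord b r) a]
  exact congrArg _ (sum_congr rfl fun b _ => by ring)

theorem coord_prod_pow (hx : IsPBasis p x) (a b : ι → Fin p) :
    hx.coord a (∏ i, x i ^ (b i : ℕ)) = if b = a then 1 else 0 := by
  have hp := (Fact.out : p.Prime).ne_zero
  rw [← hx.coord_sum (fun c => if b = c then 1 else 0) a]
  simp [ite_pow, hp]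

theorem coord_zero_one (hx : IsPBasis p x) : hx.coord 0 1 = 1 := by
  simpa using hx.coord_prod_pow 0 0

theorem adjoin_eq_top (hx : IsPBasis p x) :
    Algebra.adjoin ℤ (Set.range x ∪ Set.range fun r : R => r ^ p) = ⊤ := by
  refine top_unique fun (r : R) _ => ?_
  rw [← hx.sum_coord r]
  refine sum_mem fun a _ => mul_mem (prod_mem fun i _ => pow_mem ?_ _) ?_
  · exact Algebra.subset_adjoin (Or.inl ⟨i, rfl⟩)
  · exact Algebra.subset_adjoin (Or.inr ⟨_, rfl⟩)

theorem derivation_ext (hx : IsPBasis p x) {M : Type*} [AddCommGroup M] [Module R M]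
    {D₁ D₂ : Derivation ℤ R M} (h : ∀ i, D₁ (x i) = D₂ (x i)) : D₁ = D₂ := by
  refine Derivation.ext fun r => Derivation.eqOn_adjoin ?_ (hx.adjoin_eq_top ▸ Algebra.mem_top)
  rintro _ (⟨i, rfl⟩ | ⟨s, rfl⟩)
  · exact h i
  · exact (derivation_pow_char D₁ p s).trans (derivation_pow_char D₂ p s).symm

variable {A : Type*} [CommRing A] [Algebra A R] {d : ι → Derivation A R R}

theorem derivation_apply_eq_sum (hx : IsPBasis p x)
    (hd : ∀ i j, d i (x j) = if i = j then 1 else 0) {M : Type*} [AddCommGroup M] [Module R M]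
    (D : Derivation ℤ R M) (r : R) : D r = ∑ i, d i r • D (x i) := by
  let D' : Derivation ℤ R M :=
    ∑ i, (LinearMap.toSpanSingleton R M (D (x i))).compDer ((d i).restrictScalars ℤ)
  have hD' (r : R) : D' r = ∑ i, d i r • D (x i) := by
    rw [← Derivation.coeFnAddMonoidHom_apply, map_sum, Finset.sum_apply]
    rfl
  rw [← hD']
  congr 1
  refine hx.derivation_ext fun j => ?_
  simp [hD', hd]

end Coord

end IsPBasis

section Dual

variable {A : Type*} [CommRing A] [Algebra A R] {d : ι → Derivation A R R}

theorem derivation_prod_pow [NeZero p] (hd : ∀ i j, d i (x j) = if i = j then 1 else 0) (i : ι)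
    (a : ι → Fin p) : d i (∏ j, x j ^ (a j : ℕ)) =
      (a i : ℕ) • ∏ j, x j ^ (Function.update a i (a i - 1) j : ℕ) := by
  have hother : d i (∏ j ∈ univ.erase i, x j ^ (a j : ℕ)) = 0 :=
    prod_induction _ (fun r => d i r = 0) (fun r s hr hs => by simp [hr, hs])
      (d i).map_one_eq_zero fun j hj => by
        simp [Derivation.leibniz_pow, hd, (ne_of_mem_erase hj).symm]
  have hcongr : ∏ j ∈ univ.erase i, x j ^ (Function.update a i (a i - 1) j : ℕ) =
      ∏ j ∈ univ.erase i, x j ^ (a j : ℕ) :=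
    prod_congr rfl fun j hj => by rw [Function.update_of_ne (ne_of_mem_erase hj)]
  rw [← mul_prod_erase _ _ (mem_univ i), ← mul_prod_erase univ _ (mem_univ i), hcongr,
    Function.update_self]
  rcases eq_or_ne (a i) 0 with h0 | h0
  · simp [h0, hother]
  · simp only [Derivation.leibniz, Derivation.leibniz_pow, hother, hd, if_pos,
      Fin.val_sub_one_of_ne_zero h0, smul_eq_mul, nsmul_eq_mul]
    ring

variable [Fact p.Prime] [CharP R p]

theorem IsPBasis.coord_derivation (hx : IsPBasis p x)
    (hd : ∀ i j, d i (x j) = if i = j then 1 else 0) (i : ι) (r : R) :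
    hx.coord (Pi.single i (-1)) (d i r) = 0 := by
  rw [← hx.sum_coord r, map_sum, map_sum]
  refine sum_eq_zero fun a _ => ?_
  rw [Derivation.leibniz, derivation_pow_char, smul_zero, zero_add, smul_eq_mul, mul_comm,
    hx.isCartierLinear_coord, derivation_prod_pow hd, map_nsmul, hx.coord_prod_pow]
  split_ifs with h
  · have h0 : a i = 0 := by simpa [sub_eq_neg_self] using congrFun h i
    simp [h0]
  · simp

/-- Both sides are derivations of `f` (the left one by additivity of the inverse Cartier operator)
and they agree on the `p`-basis. -/
theorem IsPBasis.coord_pow_mul_derivation (hx : IsPBasis p x)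
    (hd : ∀ i j, d i (x j) = if i = j then 1 else 0) (i : ι) (f : R) :
    hx.coord (Pi.single i (-1)) (f ^ (p - 1) * d i f) = d i f := by
  have hp : p.Prime := Fact.out
  have hval : ((-1 : Fin p) : ℕ) = p - 1 := by
    obtain ⟨n, rfl⟩ : ∃ n, p = n + 1 := ⟨p - 1, (Nat.sub_add_cancel hp.one_le).symm⟩
    exact Fin.coe_neg_one
  have hprod : ∏ j, x j ^ ((Pi.single i (-1) : ι → Fin p) j : ℕ) = x i ^ (p - 1) := by
    rw [prod_eq_single i (fun j _ hj => by rw [Pi.single_eq_of_ne hj, Fin.val_zero, pow_zero])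
      (fun h => absurd (mem_univ i) h), Pi.single_eq_same, hval]
  have heq : cartierDerivation hp (hx.isCartierLinear_coord _) (d i) (hx.coord_derivation hd i) =
      (d i).restrictScalars ℤ := hx.derivation_ext fun j => by
    rw [cartierDerivation_apply, Derivation.restrictScalars_apply, hd]
    split_ifs with h
    · rw [mul_one, ← h, ← hprod, hx.coord_prod_pow, if_pos rfl]
    · rw [mul_zero, map_zero]
  exact congrArg (· f) heq

/-- The ideal generated by `f` and its derivatives `d i f`. -/
def jacobianIdeal (d : ι → Derivation A R R) (f : R) : Ideal R :=
  Ideal.span (insert f (Set.range fun i => d i f))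

theorem IsPBasis.jacobianIdeal_le_testIdeal (hx : IsPBasis p x)
    (hd : ∀ i j, d i (x j) = if i = j then 1 else 0) (f : R) {c : ℝ} (hc : c < 1) :
    jacobianIdeal d f ≤ testIdeal p (Ideal.span {f}) c := by
  have hp : p.Prime := Fact.out
  refine Ideal.span_le.mpr ?_
  rintro _ (rfl | ⟨i, rfl⟩)
  · refine (hx.isCartierLinear_coord 0).mem_testIdeal hp.one_lt ?_ hc
    rw [pow_sub_one_mul hp.ne_zero, ← one_mul (_ ^ p), hx.isCartierLinear_coord,
      hx.coord_zero_one, mul_one]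
  · exact (hx.isCartierLinear_coord _).mem_testIdeal hp.one_lt
      (hx.coord_pow_mul_derivation hd i f) hc

end Dual

end PBasis

section CoefficientField

open Polynomial

theorem charP_of_ringHom {A B : Type*} [CommRing A] [CommRing B] [Nontrivial B] (φ : A →+* B)
    (p : ℕ) [Fact p.Prime] [CharP A p] : CharP B p :=
  (CharP.charP_iff_prime_eq_zero Fact.out).mpr (by
    rw [← map_natCast φ, CharP.cast_eq_zero, map_zero])

theorem aeval_eq_zero_of_pow_eq_algebraMap {K B L : Type*} [Field K] [CommRing B] [Field L]
    [Algebra K B] [Algebra K L] (φ : B →ₐ[K] L) (p : ℕ) [Fact p.Prime] [CharP L p] {y : B} {a : K}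
    (ha : y ^ p = algebraMap K B a) (hy : φ y ∉ Set.range (algebraMap K L)) {g : K[X]}
    (hg : φ (aeval y g) = 0) : aeval y g = 0 := by
  have hp : p.Prime := Fact.out
  have hroot : φ y ^ p = algebraMap K L a := by rw [← map_pow, ha, φ.commutes]
  have hirr : Irreducible (X ^ p - C a) :=
    X_pow_sub_C_irreducible_of_prime hp fun b hb => hy ⟨b, frobenius_inj L p <| by
      simp only [frobenius_def, ← map_pow, hb, ha, φ.commutes]⟩
  have hmin : X ^ p - C a = minpoly K (φ y) :=
    minpoly.eq_of_irreducible_of_monic hirr (by simp [hroot]) (monic_X_pow_sub_C a hp.ne_zero)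
  obtain ⟨h, rfl⟩ : X ^ p - C a ∣ g := by
    rw [hmin]
    exact minpoly.dvd K _ (by rw [aeval_algHom_apply, hg])
  simp [ha]

variable {B : Type*} [CommRing B] [IsLocalRing B] {p : ℕ} {S : Subring B}

/-- A subring of a local ring mapping isomorphically onto the residue field. -/
def IsCoefficientField (S : Subring B) : Prop :=
  Function.Bijective ((residue B).comp S.subtype)

theorem isField_of_pow_mem_of_injective_residue (hp : p ≠ 0) (hpow : ∀ b : B, b ^ p ∈ S)
    (hS : Function.Injective ((residue B).comp S.subtype)) : IsField S where
  exists_pair_ne := ⟨0, 1, zero_ne_one⟩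
  mul_comm := mul_comm
  mul_inv_cancel {a} ha := by
    have hunit : IsUnit (a : B) := by
      rw [← residue_ne_zero_iff_isUnit]
      exact (map_ne_zero_iff _ hS).mpr ha
    obtain ⟨b, hb⟩ := hunit.exists_right_inv
    refine ⟨a ^ (p - 1) * ⟨b ^ p, hpow b⟩, Subtype.ext ?_⟩
    calc (a : B) * (a ^ (p - 1) * b ^ p) = (a * b) ^ p := by
          rw [← mul_assoc, mul_pow_sub_one hp, mul_pow]
      _ = 1 := by rw [hb, one_pow]

variable [Fact p.Prime] [CharP B p]

theorem residue_surjective_of_maximal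
    (hS : Maximal (fun S : Subring B => (∀ b : B, b ^ p ∈ S) ∧
      Function.Injective ((residue B).comp S.subtype)) S) :
    Function.Surjective ((residue B).comp S.subtype) := by
  have hp : p.Prime := Fact.out
  let : Field S := (isField_of_pow_mem_of_injective_residue hp.ne_zero hS.prop.1 hS.prop.2).toField
  let : Algebra S (ResidueField B) := ((residue B).comp S.subtype).toAlgebra
  let φ : B →ₐ[S] ResidueField B := { residue B with commutes' := fun _ => rfl }
  have : CharP (ResidueField B) p := charP_of_ringHom (residue B) p
  by_contra hsurj
  obtain ⟨z, hz⟩ := not_forall.mp hsurj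
  obtain ⟨y, rfl⟩ := residue_surjective z
  let S' : Subring B := (aeval y : S[X] →ₐ[S] B).toRingHom.range
  have hle : S ≤ S' := fun b hb => ⟨C ⟨b, hb⟩, aeval_C y _⟩
  have hinj : Function.Injective ((residue B).comp S'.subtype) := by
    rw [injective_iff_map_eq_zero]
    rintro ⟨_, g, rfl⟩ hg
    exact Subtype.ext (aeval_eq_zero_of_pow_eq_algebraMap φ p
      (a := ⟨y ^ p, hS.prop.1 y⟩) rfl hz hg)
  have hy : y ∈ S := hS.le_of_ge ⟨fun b => hle (hS.prop.1 b), hinj⟩ hle ⟨X, aeval_X y⟩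
  exact hz ⟨⟨y, hy⟩, rfl⟩

theorem exists_isCoefficientField (hB : ∀ b ∈ maximalIdeal B, b ^ p = 0) :
    ∃ S : Subring B, IsCoefficientField S := by
  have hinj (S : Subring B) : Function.Injective ((residue B).comp S.subtype) ↔
      ∀ b ∈ S, b ∈ maximalIdeal B → b = 0 := by
    simp only [injective_iff_map_eq_zero, Subtype.forall, ← residue_eq_zero_iff]
    exact forall₂_congr fun b hb => imp_congr_right fun _ => Subtype.ext_iff
  obtain ⟨S, -, hS⟩ := zorn_le_nonempty₀
    {S : Subring B | (∀ b : B, b ^ p ∈ S) ∧ Function.Injective ((residue B).comp S.subtype)}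
    (fun c hc hchain T hT => by
      refine ⟨sSup c, ⟨fun b => le_sSup hT ((hc hT).1 b), (hinj _).mpr fun b hb => ?_⟩,
        fun _ => le_sSup⟩
      obtain ⟨U, hU, hbU⟩ := (Subring.mem_sSup_of_directedOn ⟨T, hT⟩ hchain.directedOn).mp hb
      exact (hinj U).mp (hc hU).2 b hbU)
    (frobenius B p).range ⟨fun b => ⟨b, rfl⟩, (hinj _).mpr (by
      rintro _ ⟨b, rfl⟩ hb
      exact hB b ((maximalIdeal.isMaximal B).isPrime.mem_of_pow_mem p hb))⟩
  exact ⟨S, hS.prop.2, residue_surjective_of_maximal hS⟩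

end CoefficientField

section JacobianCriterion

theorem exists_retraction_of_pow_eq_zero {B : Type*} [CommRing B] [IsLocalRing B] {p : ℕ}
    [Fact p.Prime] [CharP B p] (hB : ∀ b ∈ maximalIdeal B, b ^ p = 0) :
    ∃ s : B →+* B, (∀ b ∈ maximalIdeal B, s b = 0) ∧ ∀ b, s b - b ∈ maximalIdeal B := by
  obtain ⟨S, hS⟩ := exists_isCoefficientField hB
  let e := RingEquiv.ofBijective _ hS
  refine ⟨S.subtype.comp (e.symm.toRingHom.comp (residue B)), fun b hb => ?_, fun b => ?_⟩
  · simp [(residue_eq_zero_iff b).mpr hb]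
  · rw [← residue_eq_zero_iff, map_sub, sub_eq_zero]
    exact e.apply_symm_apply (residue B b)

theorem exists_derivation_cotangent_of_retraction {A : Type*} [CommRing A] (I : Ideal A)
    (s : A ⧸ I ^ 2 →+* A ⧸ I ^ 2) (hs0 : ∀ b ∈ I.cotangentIdeal, s b = 0)
    (hs : ∀ b, s b - b ∈ I.cotangentIdeal) :
    ∃ D : Derivation ℤ A I.Cotangent, ∀ a : I, D a = I.toCotangent a := by
  let D : Derivation ℤ A I.cotangentIdeal :=
    derivationToSquareZeroOfLift I.cotangentIdeal I.cotangentIdeal_square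
      (s.comp (Ideal.Quotient.mk (I ^ 2))).toIntAlgHom
      (AlgHom.ext fun a => Ideal.Quotient.eq.mpr (hs _))
  refine ⟨-I.cotangentEquivIdeal.symm.toLinearMap.compDer D, fun ⟨a, ha⟩ => ?_⟩
  have hDa : D a = -⟨(I ^ 2).mkQ a, Submodule.mem_map_of_mem ha⟩ := Subtype.ext <| by
    have hsa : s (Ideal.Quotient.mk (I ^ 2) a) = 0 :=
      hs0 _ (Ideal.mk_mem_cotangentIdeal.mpr ha)
    calc (D a : A ⧸ I ^ 2) = s (Ideal.Quotient.mk (I ^ 2) a) - Ideal.Quotient.mk (I ^ 2) a :=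
          derivationToSquareZeroOfLift_apply _ _ _ _ _
      _ = -Ideal.Quotient.mk (I ^ 2) a := by rw [hsa, zero_sub]
  change -I.cotangentEquivIdeal.symm (D a) = _
  rw [hDa, map_neg, neg_neg, I.cotangentEquivIdeal_symm_apply]

/-- Equivalently, `𝔪 / 𝔪² → Ω ⊗ κ` is a split injection; no separability is needed because the
derivation is only `ℤ`-linear. -/
theorem exists_derivation_cotangent (A : Type*) [CommRing A] [IsLocalRing A] (p : ℕ)
    [Fact p.Prime] [CharP A p] : ∃ D : Derivation ℤ A (maximalIdeal A).Cotangent,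
      ∀ a : maximalIdeal A, D a = (maximalIdeal A).toCotangent a := by
  set m := maximalIdeal A
  have hmk : Function.Surjective (Ideal.Quotient.mk (m ^ 2)) := Ideal.Quotient.mk_surjective
  have hne : m ^ 2 ≠ ⊤ := fun h =>
    (maximalIdeal.isMaximal A).ne_top (top_le_iff.mp (h ▸ Ideal.pow_le_self two_ne_zero))
  have : Nontrivial (A ⧸ m ^ 2) := Ideal.Quotient.nontrivial_iff.mpr hne
  have : IsLocalRing (A ⧸ m ^ 2) := .of_surjective' _ hmk
  have : IsLocalHom (Ideal.Quotient.mk (m ^ 2)) := .of_surjective _ hmk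
  have : CharP (A ⧸ m ^ 2) p := charP_of_ringHom (Ideal.Quotient.mk (m ^ 2)) p
  have hm : maximalIdeal (A ⧸ m ^ 2) = m.cotangentIdeal :=
    Ideal.comap_injective_of_surjective _ hmk
      ((maximalIdeal_comap _).trans m.comap_cotangentIdeal.symm)
  obtain ⟨s, hs0, hs⟩ := exists_retraction_of_pow_eq_zero (B := A ⧸ m ^ 2) (p := p) fun b hb =>
    pow_eq_zero_of_le (Fact.out : p.Prime).two_le <| by
      rw [← Ideal.mem_bot, ← m.cotangentIdeal_square, ← hm]
      exact Ideal.pow_mem_pow hb 2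
  exact exists_derivation_cotangent_of_retraction m s (hm ▸ hs0) (hm ▸ hs)

theorem IsPBasis.algebraMap_mem_maximalIdeal_sq {R : Type*} [CommRing R] {p : ℕ} [Fact p.Prime]
    [CharP R p] {ι : Type*} [Fintype ι] [DecidableEq ι] {x : ι → R} {k : Type*} [CommRing k]
    [Algebra k R] {d : ι → Derivation k R R}
    (hx : IsPBasis p x) (hd : ∀ i j, d i (x j) = if i = j then 1 else 0) {f : R} {P : Ideal R}
    [P.IsPrime] (hf : jacobianIdeal d f ≤ P) (A : Type*) [CommRing A] [IsLocalRing A] [Algebra R A]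
    [IsLocalization.AtPrime A P] : algebraMap R A f ∈ maximalIdeal A ^ 2 := by
  have hmem {r : R} (hr : r ∈ jacobianIdeal d f) : algebraMap R A r ∈ maximalIdeal A :=
    (IsLocalization.AtPrime.to_map_mem_maximal_iff A P r).mpr (hf hr)
  have hfm := hmem (Ideal.subset_span (Set.mem_insert _ _))
  have : CharP A p := charP_of_ringHom (algebraMap R A) p
  obtain ⟨D, hD⟩ := exists_derivation_cotangent A p
  have hDf : D (algebraMap R A f) = 0 := by
    have := hx.derivation_apply_eq_sum hd (D.compAlgebraMap R) f
    refine this.trans (Finset.sum_eq_zero fun i _ => ?_)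
    rw [← algebraMap_smul A]
    exact Ideal.Cotangent.smul_eq_zero_of_mem
      (hmem (Ideal.subset_span (Set.mem_insert_of_mem _ ⟨i, rfl⟩))) _
  rw [hD ⟨_, hfm⟩] at hDf
  exact (Ideal.toCotangent_eq_zero _ _).mp hDf

end JacobianCriterion

section NonRegular

section Surjection

variable {A C : Type*} [CommRing A] [CommRing C] [IsLocalRing A] [IsLocalRing C]
  [IsNoetherianRing A] {π : A →+* C}

theorem span_eq_maximalIdeal_of_span_image (hπ : Function.Surjective π)
    (hker : RingHom.ker π ≤ maximalIdeal A ^ 2) {T : Set A}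
    (hT : Ideal.span (π '' T) = maximalIdeal C) : Ideal.span T = maximalIdeal A := by
  have : IsLocalHom π := .of_surjective π hπ
  have hcomap : maximalIdeal A = Ideal.span T ⊔ RingHom.ker π := by
    rw [← Ideal.comap_map_of_surjective' π hπ, Ideal.map_span, hT, maximalIdeal_comap]
  refine le_antisymm (hcomap ▸ le_sup_left) ?_
  refine Submodule.le_of_le_smul_of_le_jacobson_bot (IsNoetherian.noetherian _)
    (maximalIdeal_le_jacobson _) ?_
  rw [smul_eq_mul, ← sq]
  exact hcomap.le.trans (sup_le_sup_left hker _)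

theorem spanFinrank_maximalIdeal_le_of_surjective (hπ : Function.Surjective π)
    (hker : RingHom.ker π ≤ maximalIdeal A ^ 2) :
    (maximalIdeal A).spanFinrank ≤ (maximalIdeal C).spanFinrank := by
  have : IsNoetherianRing C := isNoetherianRing_of_surjective A C π hπ
  have hfg : Submodule.FG (maximalIdeal C) := IsNoetherian.noetherian _
  let T : Set A := Function.surjInv hπ '' (maximalIdeal C).generators
  have hspan : Ideal.span T = maximalIdeal A := by
    refine span_eq_maximalIdeal_of_span_image hπ hker ?_
    simp only [T, Set.image_image, Function.surjInv_eq, Set.image_id']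
    exact Submodule.span_generators _
  calc (maximalIdeal A).spanFinrank ≤ T.ncard := by
        rw [← hspan]
        exact Submodule.spanFinrank_span_le_ncard_of_finite (hfg.finite_generators.image _)
    _ ≤ (maximalIdeal C).generators.ncard := Set.ncard_image_le hfg.finite_generators
    _ = (maximalIdeal C).spanFinrank := hfg.generators_ncard

/-- Passing to `C` lowers the dimension but not the embedding dimension. -/
theorem not_isRegularLocalRing_of_ker_le_sq (hπ : Function.Surjective π)
    (hker : RingHom.ker π ≤ maximalIdeal A ^ 2) {a : A} (ha : a ∈ nonZeroDivisors A)
    (haπ : π a = 0) : ¬ IsRegularLocalRing C := fun hC => by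
  have hdim := (ringKrullDim_succ_le_of_surjective π hπ ha haπ).trans
    (ringKrullDim_le_spanFinrank_maximalIdeal A)
  rw [← (isRegularLocalRing_iff C).mp hC] at hdim
  have hle := spanFinrank_maximalIdeal_le_of_surjective hπ hker
  have hlt : (maximalIdeal C).spanFinrank + 1 ≤ (maximalIdeal A).spanFinrank := by
    exact_mod_cast hdim
  omega

end Surjection

variable {R : Type*} [CommRing R] [IsNoetherianRing R] {f : R}

theorem not_isRegularLocalRing_quotient_span_singleton (hf : f ∈ nonZeroDivisors R)
    (Q : Ideal (R ⧸ Ideal.span {f})) [Q.IsPrime]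
    (hsq : algebraMap R (Localization.AtPrime (Q.comap (Ideal.Quotient.mk (Ideal.span {f})))) f ∈
      maximalIdeal _ ^ 2) : ¬ IsRegularLocalRing (Localization.AtPrime Q) := by
  set π := Ideal.Quotient.mk (Ideal.span {f})
  have hπ : Function.Surjective π := Ideal.Quotient.mk_surjective
  have : IsLocalization ((Q.comap π).primeCompl.map π) (Localization.AtPrime Q) :=
    (Submonoid.map_comap_eq_of_surjective hπ Q.primeCompl).symm ▸ Localization.isLocalization
  refine not_isRegularLocalRing_of_ker_le_sq
    (RingHom.surjective_localRingHom_of_surjective _ hπ Q) ?_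
    (a := algebraMap R _ f) ?_ ?_
  · refine (IsLocalization.ker_map (Localization.AtPrime Q) _ rfl).trans_le ?_
    rwa [Ideal.mk_ker, Ideal.map_span, Set.image_singleton, Ideal.span_singleton_le_iff_mem]
  · exact IsLocalization.nonZeroDivisors_le_comap (Q.comap π).primeCompl _ hf
  · rw [Localization.localRingHom_to_map,
      Ideal.Quotient.eq_zero_iff_mem.mpr (Ideal.mem_span_singleton_self f), map_zero]

variable {p : ℕ} [Fact p.Prime] [CharP R p] {ι : Type*} [Fintype ι] [DecidableEq ι] {x : ι → R}
  {k : Type*} [CommRing k] [Algebra k R] {d : ι → Derivation k R R}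

theorem IsPBasis.isMaximal_of_jacobianIdeal_le (hx : IsPBasis p x)
    (hd : ∀ i j, d i (x j) = if i = j then 1 else 0) (hf : f ∈ nonZeroDivisors R)
    (hsing : HasIsolatedSingularity f) {P : Ideal R} [P.IsPrime] (hP : jacobianIdeal d f ≤ P) :
    P.IsMaximal := by
  set π := Ideal.Quotient.mk (Ideal.span {f})
  have hπ : Function.Surjective π := Ideal.Quotient.mk_surjective
  have hker : RingHom.ker π ≤ P := by
    rw [Ideal.mk_ker, Ideal.span_singleton_le_iff_mem]
    exact hP (Ideal.subset_span (Set.mem_insert _ _))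
  have : (P.map π).IsPrime := Ideal.map_isPrime_of_surjective hπ hker
  have hcomap : (P.map π).comap π = P := by
    rw [Ideal.comap_map_of_surjective' π hπ, sup_eq_left.mpr hker]
  have hmax : (P.map π).IsMaximal := hsing _ <|
    not_isRegularLocalRing_quotient_span_singleton hf _ <|
      hx.algebraMap_mem_maximalIdeal_sq hd (P := (P.map π).comap π) (hcomap.symm ▸ hP) _
  rw [← hcomap]
  exact Ideal.comap_isMaximal_of_surjective π hπ

theorem IsPBasis.krullDimLE_zero_quotient_jacobianIdeal (hx : IsPBasis p x)
    (hd : ∀ i j, d i (x j) = if i = j then 1 else 0) (hf : f ∈ nonZeroDivisors R)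
    (hsing : HasIsolatedSingularity f) : Ring.KrullDimLE 0 (R ⧸ jacobianIdeal d f) := by
  refine Ring.KrullDimLE.mk₀ fun Q _ => ?_
  have hmk : Function.Surjective (Ideal.Quotient.mk (jacobianIdeal d f)) :=
    Ideal.Quotient.mk_surjective
  have hle : jacobianIdeal d f ≤ Q.comap (Ideal.Quotient.mk (jacobianIdeal d f)) :=
    Ideal.mk_ker.ge.trans (Ideal.comap_mono bot_le)
  have := hx.isMaximal_of_jacobianIdeal_le hd hf hsing hle
  rw [← Ideal.map_comap_of_surjective _ hmk Q]
  exact Ideal.IsMaximal.map_of_surjective_of_ker_le hmk (Ideal.mk_ker.trans_le hle)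

end NonRegular

section Counting

variable {k R : Type*} [Field k] [CommRing R] [Algebra k R]

theorem finrank_quotient_lt {I J : Ideal R} (h : I < J) [Module.Finite k (R ⧸ I)] :
    Module.finrank k (R ⧸ J) < Module.finrank k (R ⧸ I) := by
  let π : (R ⧸ I) →ₗ[k] R ⧸ J := (Ideal.Quotient.factorₐ k h.le).toLinearMap
  have hπ : LinearMap.range π = ⊤ :=
    LinearMap.range_eq_top.mpr (Ideal.Quotient.factor_surjective h.le)
  have hker : LinearMap.ker π ≠ ⊥ := by
    obtain ⟨r, hrJ, hrI⟩ := SetLike.exists_of_lt h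
    exact (Submodule.ne_bot_iff _).mpr ⟨Ideal.Quotient.mk I r,
      Ideal.Quotient.eq_zero_iff_mem.mpr hrJ, mt Ideal.Quotient.eq_zero_iff_mem.mp hrI⟩
  have hrank := π.finrank_range_add_finrank_ker
  rw [hπ, finrank_top] at hrank
  have := Submodule.one_le_finrank_iff.mpr hker
  omega

theorem finrank_quotient_le {I J : Ideal R} (h : I ≤ J) [Module.Finite k (R ⧸ I)] :
    Module.finrank k (R ⧸ J) ≤ Module.finrank k (R ⧸ I) :=
  LinearMap.finrank_le_finrank_of_surjective (f := (Ideal.Quotient.factorₐ k h).toLinearMap)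
    (Ideal.Quotient.factor_surjective h)

variable (p : ℕ) (J : Ideal R) {K : Ideal R} [Module.Finite k (R ⧸ K)] {b : ℝ}

theorem encard_isFJumpingCoefficient_lt_le (hK : ∀ c < b, K ≤ testIdeal p J c) :
    {c : ℝ | c < b ∧ IsFJumpingCoefficient p J c}.encard ≤ Module.finrank k (R ⧸ K) := by
  let N : ℝ → ℕ := fun c => Module.finrank k (R ⧸ testIdeal p J c)
  have hlt {c' c : ℝ} (h0 : 0 ≤ c') (h : c' < c) (hcb : c < b)
      (hc : IsFJumpingCoefficient p J c) : N c' < N c := by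
    have : Module.Finite k (R ⧸ testIdeal p J c) :=
      Module.Finite.of_surjective (Ideal.Quotient.factorₐ k (hK c hcb)).toLinearMap
        (Ideal.Quotient.factor_surjective (hK c hcb))
    exact finrank_quotient_lt (hc.2 c' h0 h)
  have hmaps : Set.MapsTo N {c | c < b ∧ IsFJumpingCoefficient p J c}
      (Finset.Icc 1 (Module.finrank k (R ⧸ K)) : Finset ℕ) := fun c ⟨hcb, hc⟩ =>
    Finset.mem_coe.mpr <| Finset.mem_Icc.mpr
      ⟨Nat.one_le_of_lt (hlt le_rfl hc.1 hcb hc), finrank_quotient_le (hK c hcb)⟩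
  have hmono : StrictMonoOn N {c | c < b ∧ IsFJumpingCoefficient p J c} :=
    fun _ ⟨_, hc'⟩ _ ⟨hcb, hc⟩ h => hlt hc'.1.le h hcb hc
  simpa only [Set.encard_coe_eq_coe_finsetCard, Nat.card_Icc, Nat.add_sub_cancel] using
    Set.encard_le_encard_of_injOn hmaps hmono.injOn

theorem encard_isFJumpingCoefficient_Icc_le (hK : ∀ c < b, K ≤ testIdeal p J c) :
    {c : ℝ | c ∈ Set.Icc 0 b ∧ IsFJumpingCoefficient p J c}.encard ≤
      ((Module.finrank k (R ⧸ K) + 1 : ℕ) : ℕ∞) := by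
  have hsub : {c : ℝ | c ∈ Set.Icc 0 b ∧ IsFJumpingCoefficient p J c} ⊆
      insert b {c | c < b ∧ IsFJumpingCoefficient p J c} := fun c ⟨hc, hjump⟩ =>
    hc.2.eq_or_lt.imp_right fun h => ⟨h, hjump⟩
  calc _ ≤ (insert b {c : ℝ | c < b ∧ IsFJumpingCoefficient p J c}).encard :=
        Set.encard_le_encard hsub
    _ ≤ {c : ℝ | c < b ∧ IsFJumpingCoefficient p J c}.encard + 1 := Set.encard_insert_le _ _
    _ ≤ ((Module.finrank k (R ⧸ K) + 1 : ℕ) : ℕ∞) := by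
        push_cast
        gcongr
        exact encard_isFJumpingCoefficient_lt_le p J hK

end Counting

section Instances

variable {σ k : Type*} {p : ℕ}

section Coefficients

open MvPowerSeries

theorem exists_nsmul_add_equivFunOnFinite_symm_eq [Finite σ] [NeZero p] (l : σ →₀ ℕ) :
    ∃ (m : σ →₀ ℕ) (a : σ → Fin p),
      p • m + Finsupp.equivFunOnFinite.symm (fun i => (a i : ℕ)) = l :=
  ⟨Finsupp.equivFunOnFinite.symm fun i => l i / p, fun i => Fin.ofNat p (l i),
    Finsupp.ext fun i => by simp [Nat.div_add_mod]⟩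

variable [CommRing k]

theorem prod_X_pow_eq_monomial [Fintype σ] (a : σ → ℕ) :
    (∏ i, X i ^ a i : MvPowerSeries σ k) = monomial (Finsupp.equivFunOnFinite.symm a) 1 := by
  rw [monomial_eq', map_one, one_mul, Finsupp.prod_fintype _ _ fun _ => pow_zero _]
  rfl

variable [Fact p.Prime] [CharP k p]

theorem coeff_nsmul_pow (s : MvPowerSeries σ k) (m : σ →₀ ℕ) :
    coeff (p • m) (s ^ p) = coeff m s ^ p := by
  rw [← map_frobenius_expand p (NeZero.ne p), coeff_map, coeff_expand_smul, frobenius_def]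

theorem coeff_pow_of_not_dvd (s : MvPowerSeries σ k) {m : σ →₀ ℕ} {i : σ} (h : ¬p ∣ m i) :
    coeff m (s ^ p) = 0 := by
  rw [← map_frobenius_expand p (NeZero.ne p), coeff_map, coeff_expand_of_not_dvd p _ _ h, map_zero]

variable [Fintype σ] [DecidableEq σ]

theorem coeff_sum_prod_X_pow_mul_pow (g : (σ → Fin p) → MvPowerSeries σ k) (m : σ →₀ ℕ)
    (a : σ → Fin p) :
    coeff (p • m + Finsupp.equivFunOnFinite.symm fun i => (a i : ℕ))
      (∑ b, (∏ i, X i ^ (b i : ℕ)) * g b ^ p) =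
        coeff m (g a) ^ p := by
  simp only [prod_X_pow_eq_monomial, map_sum]
  rw [Finset.sum_eq_single a]
  · rw [add_comm, coeff_add_monomial_mul, one_mul, coeff_nsmul_pow]
  · intro b _ hba
    rw [coeff_monomial_mul, one_mul]
    split_ifs with hle
    · obtain ⟨i, hi⟩ := Function.ne_iff.mp hba
      refine coeff_pow_of_not_dvd _ (i := i) fun hdvd => hi (Fin.ext ?_)
      have hmod := (Nat.modEq_iff_dvd' (hle i)).mpr hdvd
      simpa [Nat.ModEq, Nat.mod_eq_of_lt] using hmod
    · rfl
  · simp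

end Coefficients

section IsPBasis

variable [Fintype σ] [DecidableEq σ] [CommRing k] [Fact p.Prime] [CharP k p] [PerfectRing k p]

theorem isPBasis_mvPowerSeries_X : IsPBasis p (MvPowerSeries.X : σ → MvPowerSeries σ k) := by
  refine ⟨fun g h hgh => ?_, fun f => ?_⟩
  · ext a m
    refine (frobeniusEquiv k p).injective ?_
    simpa only [frobeniusEquiv_apply, frobenius_def, coeff_sum_prod_X_pow_mul_pow] using
      congrArg (MvPowerSeries.coeff
        (p • m + Finsupp.equivFunOnFinite.symm fun i => (a i : ℕ))) hgh
  · let g (a : σ → Fin p) : MvPowerSeries σ k := fun m => (frobeniusEquiv k p).symm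
      (MvPowerSeries.coeff (p • m + Finsupp.equivFunOnFinite.symm fun i => (a i : ℕ)) f)
    refine ⟨g, MvPowerSeries.ext fun l => ?_⟩
    obtain ⟨m, a, rfl⟩ := exists_nsmul_add_equivFunOnFinite_symm_eq (p := p) l
    exact (coeff_sum_prod_X_pow_mul_pow g m a).trans (frobeniusEquiv_symm_pow_p k p _)

theorem isPBasis_mvPolynomial_X : IsPBasis p (MvPolynomial.X : σ → MvPolynomial σ k) := by
  refine ⟨fun g h hgh => ?_, fun f => ?_⟩
  · have hcoe := isPBasis_mvPowerSeries_X.injective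
      (a₁ := fun a => (g a : MvPowerSeries σ k)) (a₂ := fun a => (h a : MvPowerSeries σ k)) <| by
        simpa only [map_sum, map_mul, map_prod, map_pow,
          MvPolynomial.coeToMvPowerSeries.ringHom_apply, MvPolynomial.coe_X] using
          congrArg MvPolynomial.coeToMvPowerSeries.ringHom hgh
    exact funext fun a => MvPolynomial.coe_injective σ k (congrFun hcoe a)
  · induction f using MvPolynomial.induction_on' with
    | monomial l c =>
      obtain ⟨m, a, rfl⟩ := exists_nsmul_add_equivFunOnFinite_symm_eq (p := p) l
      obtain ⟨b, rfl⟩ := (frobeniusEquiv k p).surjective c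
      refine ⟨Pi.single a (MvPolynomial.monomial m b), ?_⟩
      have hX : ∏ i, (MvPolynomial.X i : MvPolynomial σ k) ^ (a i : ℕ) =
          MvPolynomial.monomial (Finsupp.equivFunOnFinite.symm fun i => (a i : ℕ)) 1 := by
        rw [MvPolynomial.monomial_eq, map_one, one_mul,
          Finsupp.prod_fintype _ _ fun _ => pow_zero _]
        rfl
      refine (Fintype.sum_eq_single a fun b hb => ?_).trans ?_
      · rw [Pi.single_eq_of_ne hb, zero_pow (NeZero.ne p), mul_zero]
      · rw [Pi.single_eq_same, hX, MvPolynomial.monomial_pow, MvPolynomial.monomial_mul, one_mul,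
          add_comm, frobeniusEquiv_apply, frobenius_def]
    | add f₁ f₂ h₁ h₂ =>
      obtain ⟨g₁, rfl⟩ := h₁
      obtain ⟨g₂, rfl⟩ := h₂
      exact ⟨g₁ + g₂, by simp only [Pi.add_apply, add_pow_char, mul_add, Finset.sum_add_distrib]⟩

end IsPBasis

section Finiteness

variable [Field k]

theorem finite_quotient_of_krullDimLE_zero {R : Type*} [CommRing R] [IsLocalRing R]
    [IsNoetherianRing R] [Algebra k R] [Module.Finite k (ResidueField R)] (J : Ideal R)
    [Ring.KrullDimLE 0 (R ⧸ J)] : Module.Finite k (R ⧸ J) := by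
  have : IsArtinianRing (R ⧸ J) := isArtinianRing_iff_isNoetherianRing_krullDimLE_zero.mpr
    ⟨inferInstance, inferInstance⟩
  have hle : maximalIdeal R ≤ (Ring.jacobson (R ⧸ J)).comap (Ideal.Quotient.mk J) := by
    rw [← Ideal.jacobson_bot, Ideal.comap_jacobson_of_surjective Ideal.Quotient.mk_surjective]
    exact (maximalIdeal_le_jacobson ⊥).trans (Ideal.jacobson_mono bot_le)
  have : Module.Finite k (R ⧸ maximalIdeal R) := inferInstanceAs (Module.Finite k (ResidueField R))
  have : Module.Finite k ((R ⧸ J) ⧸ Ring.jacobson (R ⧸ J)) :=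
    Module.Finite.of_surjective
      (Ideal.quotientMapₐ _ (Ideal.Quotient.mkₐ k J) hle).toLinearMap
      (Ideal.quotientMap_surjective (H := hle) Ideal.Quotient.mk_surjective)
  exact IsSemiprimaryRing.finite_of_isArtinian k (R ⧸ J) (R ⧸ J)

instance finite_residueField_mvPowerSeries :
    Module.Finite k (ResidueField (MvPowerSeries σ k)) := by
  refine Module.Finite.of_surjective (Algebra.linearMap k _) fun z => ?_
  obtain ⟨f, rfl⟩ := residue_surjective z
  refine ⟨MvPowerSeries.constantCoeff f, ?_⟩
  change residue _ (MvPowerSeries.C (MvPowerSeries.constantCoeff f)) = _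
  rw [← sub_eq_zero, ← map_sub, residue_eq_zero_iff, mem_maximalIdeal, mem_nonunits_iff,
    MvPowerSeries.isUnit_iff_constantCoeff]
  simp

end Finiteness

end Instances

end FJump

/-- For a polynomial ring `hfin` is Zariski's lemma. -/
theorem mainTheorem2_general {k R ι : Type*} [Field k] [CommRing R] [Algebra k R]
    [IsNoetherianRing R] {p : ℕ} [Fact p.Prime] [CharP R p] [Fintype ι] [DecidableEq ι]
    {x : ι → R} {d : ι → Derivation k R R} (hx : FJump.IsPBasis p x)
    (hd : ∀ i j, d i (x j) = if i = j then 1 else 0)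
    (hfin : ∀ J : Ideal R, Ring.KrullDimLE 0 (R ⧸ J) → Module.Finite k (R ⧸ J)) {f : R}
    (hf : f ∈ nonZeroDivisors R) (hsing : FJump.HasIsolatedSingularity f) :
    Module.Finite k (R ⧸ FJump.jacobianIdeal d f) ∧
      Set.encard {c : ℝ | c ∈ Set.Icc (0 : ℝ) 1 ∧
          FJump.IsFJumpingCoefficient p (Ideal.span {f}) c} ≤
        ((Module.finrank k (R ⧸ FJump.jacobianIdeal d f) + 1 : ℕ) : ℕ∞) := by
  have hJac := hfin _ (hx.krullDimLE_zero_quotient_jacobianIdeal hd hf hsing)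
  exact ⟨hJac, FJump.encard_isFJumpingCoefficient_Icc_le p _ fun _ hc =>
    hx.jacobianIdeal_le_testIdeal hd f hc⟩

theorem mainTheorem2 {k : Type*} [Field k] [PerfectField k] (p : ℕ) (hp : p.Prime) [CharP k p]
    (n : ℕ) :
    (∀ f : MvPolynomial (Fin n) k, f ≠ 0 → FJump.HasIsolatedSingularity f →
      Module.Finite k (MvPolynomial (Fin n) k ⧸ FJump.polyJac f) ∧
      Set.encard {c : ℝ | c ∈ Set.Icc (0 : ℝ) 1 ∧
          FJump.IsFJumpingCoefficient p (Ideal.span {f}) c} ≤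
        ((Module.finrank k (MvPolynomial (Fin n) k ⧸ FJump.polyJac f) + 1 : ℕ) : ℕ∞)) ∧
    (∀ f : MvPowerSeries (Fin n) k, f ≠ 0 → FJump.HasIsolatedSingularity f →
      Module.Finite k (MvPowerSeries (Fin n) k ⧸ FJump.seriesJac f) ∧
      Set.encard {c : ℝ | c ∈ Set.Icc (0 : ℝ) 1 ∧
          FJump.IsFJumpingCoefficient p (Ideal.span {f}) c} ≤
        ((Module.finrank k (MvPowerSeries (Fin n) k ⧸ FJump.seriesJac f) + 1 : ℕ) : ℕ∞)) := by
  have : Fact p.Prime := ⟨hp⟩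
  have : PerfectRing k p := PerfectField.toPerfectRing p
  have : CharP (MvPowerSeries (Fin n) k) p := FJump.charP_of_ringHom MvPowerSeries.C p
  constructor <;> intro f hf hsing
  · exact mainTheorem2_general FJump.isPBasis_mvPolynomial_X (d := MvPolynomial.pderiv)
      (fun i j => by simp [MvPolynomial.pderiv_X, Pi.single_apply, eq_comm])
      (fun J hJ => (Module.finite_iff_krullDimLE_zero k _).mpr hJ)
      (mem_nonZeroDivisors_of_ne_zero hf) hsing
  · exact mainTheorem2_general FJump.isPBasis_mvPowerSeries_X (d := MvPowerSeries.pderiv k)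
      (fun i j => by simp [MvPowerSeries.pderiv_X, Pi.single_apply, eq_comm])
      (fun J _ => FJump.finite_quotient_of_krullDimLE_zero J)
      (mem_nonZeroDivisors_of_ne_zero hf) hsing
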